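/- Let $y_1<y_2$ be real numbers, $\tau\in(0,\infty)$, $c\in(0,1)$, $M_c=y_1+c(y_2-y_1)$. For $x\in(y_1,y_2)$ let $$N(x)=\begin{cases}\left(x-\tau(x-y_1),\,x+\frac{\tau(1-c)(x-y_1)}{c}\right)\cap(y_1,y_2)&\text{if }x\le M_c,\\[2pt]\left(x-\frac{c\tau(y_2-x)}{1-c},\,x+\tau(y_2-x)\right)\cap(y_1,y_2)&\text{if }x> M_c,\end{cases}$$ be the central similarity proximity region of $x$. Let $X_1,X_2,\ldots$ be independent random variables, each uniformly distributed on $(y_1,y_2)$. For $n\ge 2$ let $\rho_{n,2}(\tau,c)$ be the relative density of the digraph with vertices $X_1,\dots,X_n$ and arcs $(X_i,X_j)$, $i\ne j$, whenever $X_j\in N(X_i)$, that is, the number of arcs divided by $n(n-1)$. Let $\mu(\tau,c)=P(X_2\in N(X_1))$ be the arc probability, let $h_{ij}=\frac12\left(\mathbf 1\{X_j\in N(X_i)\}+\mathbf 1\{X_i\in N(X_j)\}\right)$, and let $\nu(\tau,c)=\operatorname{Cov}[h_{12},h_{13}]$. Then $\nu(\tau,c)>0$ and, as $n\to\infty$,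 $$\sqrt n\,\left[\rho_{n,2}(\tau,c)-\mu(\tau,c)\right]\ \xrightarrow{\ \mathcal L\ }\ \mathcal N(0,4\nu(\tau,c)),$$ where $\mu(\tau,c)=\mu_1(\tau,c)$ and $\nu(\tau,c)=\nu_1(\tau,c)$ for $0<c\le 1/2$, and $\mu(\tau,c)=\mu_1(\tau,1-c)$ and $\nu(\tau,c)=\nu_1(\tau,1-c)$ for $1/2<c<1$, with $$\mu_1(\tau,c)=\begin{cases}\frac{\tau}{2}&\text{if }0<\tau<1,\\[2pt]\frac{\tau\,(1+2c(\tau-1)(1-c))}{2(c\tau-c+1)(\tau+c-c\tau)}&\text{if }\tau\ge1,\end{cases}\qquad 4\nu_1(\tau,c)=\begin{cases}\kappa_1(\tau,c)&\text{if }0<\tau<1,\\ \kappa_2(\tau,c)&\text{if }\tau\ge1,\end{cases}$$ $$\kappa_1(\tau,c)=\frac{\tau^2\left(c^2\tau^3-3c^2\tau^2-c\tau^3+2c^2\tau+3c\tau^2-c^2-2c\tau-\tau^2+c+\tau\right)}{3(c\tau-c+1)(c+\tau-c\tau)},$$ $$\kappa_2(\tau,c)=\frac{c(1-c)\,Q(\tau,c)}{3(c\tau-c+1)^3(c\tau-c-\tau)^3},$$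 $$\begin{aligned}Q(\tau,c)={}&2c^4\tau^5-7c^4\tau^4-4c^3\tau^5+8c^4\tau^3+14c^3\tau^4+3c^2\tau^5-2c^4\tau^2-16c^3\tau^3-7c^2\tau^4-c\tau^5\\&-2c^4\tau+4c^3\tau^2+12c^2\tau^3+c^4+4c^3\tau-6c^2\tau^2-4c\tau^3-2c^3-3c^2\tau+4c\tau^2+c^2+c\tau-\tau^2.\end{aligned}$$ -/

import Mathlib

open MeasureTheory ProbabilityTheory Filter Set

noncomputable section

/-- The central similarity proximity region `N(x, τ, c)` of a point `x` of the middle interval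
`(y₁, y₂)`, with expansion parameter `τ` and centrality parameter `c`; `M_c = y₁ + c (y₂ - y₁)`.
At `x = M_c` the two formulas give the same interval, so that the choice made there is
immaterial. The region of an endpoint `y₁`, `y₂` is the point itself. -/
def csRegion (y₁ y₂ τ c x : ℝ) : Set ℝ :=
  if x = y₁ ∨ x = y₂ then {x}
  else if x ≤ y₁ + c * (y₂ - y₁) then
    Ioo (x - τ * (x - y₁)) (x + τ * (1 - c) * (x - y₁) / c) ∩ Ioo y₁ y₂
  else
    Ioo (x - c * τ * (y₂ - x) / (1 - c)) (x + τ * (y₂ - x)) ∩ Ioo y₁ y₂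

/-- The central similarity proximity catch digraph on the points `x 0, …, x (n-1)` of
`(y₁, y₂)`: there is an arc `(i, j)`, `i ≠ j`, iff `x j ∈ N(x i, τ, c)`. -/
def csDigraph {n : ℕ} (y₁ y₂ τ c : ℝ) (x : Fin n → ℝ) : Digraph (Fin n) where
  Adj i j := i ≠ j ∧ x j ∈ csRegion y₁ y₂ τ c (x i)

/-- The relative density of a (loopless) digraph of order `n`: the number of arcs divided by
`n (n - 1)`. For `n ≤ 1` its value is `0`, as a quotient by `0`. -/
def relativeDensity {n : ℕ} (D : Digraph (Fin n)) : ℝ :=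
  (Set.ncard {p : Fin n × Fin n | D.Adj p.1 p.2} : ℝ) / ((n : ℝ) * ((n : ℝ) - 1))

/-- The symmetric kernel `h`: half the number of arcs between two points `x` and `x'`. -/
def csKernel (y₁ y₂ τ c x x' : ℝ) : ℝ :=
  ((csRegion y₁ y₂ τ c x).indicator (fun _ => (1 : ℝ)) x'
    + (csRegion y₁ y₂ τ c x').indicator (fun _ => (1 : ℝ)) x) / 2

/-- `μ₁(τ, c)`, for `0 < c ≤ 1/2`. -/
def csMean₁ (τ c : ℝ) : ℝ :=
  if τ < 1 then τ / 2
  else τ * (1 + 2 * c * (τ - 1) * (1 - c)) / (2 * (c * τ - c + 1) * (τ + c - c * τ))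

/-- `κ₁(τ, c)`. -/
def csKappa₁ (τ c : ℝ) : ℝ :=
  τ ^ 2 * (c ^ 2 * τ ^ 3 - 3 * c ^ 2 * τ ^ 2 - c * τ ^ 3 + 2 * c ^ 2 * τ + 3 * c * τ ^ 2
      - c ^ 2 - 2 * c * τ - τ ^ 2 + c + τ)
    / (3 * (c * τ - c + 1) * (c + τ - c * τ))

/-- `κ₂(τ, c)`. -/
def csKappa₂ (τ c : ℝ) : ℝ :=
  c * (1 - c) * (2 * c ^ 4 * τ ^ 5 - 7 * c ^ 4 * τ ^ 4 - 4 * c ^ 3 * τ ^ 5 + 8 * c ^ 4 * τ ^ 3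
      + 14 * c ^ 3 * τ ^ 4 + 3 * c ^ 2 * τ ^ 5 - 2 * c ^ 4 * τ ^ 2 - 16 * c ^ 3 * τ ^ 3
      - 7 * c ^ 2 * τ ^ 4 - c * τ ^ 5 - 2 * c ^ 4 * τ + 4 * c ^ 3 * τ ^ 2 + 12 * c ^ 2 * τ ^ 3
      + c ^ 4 + 4 * c ^ 3 * τ - 6 * c ^ 2 * τ ^ 2 - 4 * c * τ ^ 3 - 2 * c ^ 3 - 3 * c ^ 2 * τ
      + 4 * c * τ ^ 2 + c ^ 2 + c * τ - τ ^ 2)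
    / (3 * (c * τ - c + 1) ^ 3 * (c * τ - c - τ) ^ 3)

/-- `ν₁(τ, c)`, for `0 < c ≤ 1/2`: `4 ν₁` is `κ₁` for `τ < 1` and `κ₂` for `τ ≥ 1`. -/
def csNu₁ (τ c : ℝ) : ℝ :=
  (if τ < 1 then csKappa₁ τ c else csKappa₂ τ c) / 4

/-- `μ(τ, c)`. -/
def csMean (τ c : ℝ) : ℝ :=
  if c ≤ 1 / 2 then csMean₁ τ c else csMean₁ τ (1 - c)

/-- `ν(τ, c)`. -/
def csNu (τ c : ℝ) : ℝ :=
  if c ≤ 1 / 2 then csNu₁ τ c else csNu₁ τ (1 - c)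

end

/-! The relative density is the average over ordered pairs of the bounded kernel `a x y = 1{y ∈
N(x)}`, so it is a U-statistic and Hoeffding's projection applies. With `p` and `q` the means of `a`
in its second and first argument, `a x y = p x + q y - μ + r x y`, where `r` integrates to zero in
each variable. In the second moment of the sum of `r` over pairs, two pairs contribute only if they
have the same pair of indices, so this moment is of order `n²` (`integral_sq_sum_degenerate_le`) and
the part vanishes in probability after scaling. What remains is a normalized sum of the i.i.d.
variables `p (Y i) + q (Y i)`; the classical central limit theorem and Slutsky's argument give
`tendstoInDistribution_average_offDiag`. The projection of the symmetric kernel `h` is `(p + q) /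
2`, hence the limit variance `4ν`.

The rest is explicit. An affine change of variable reduces to the unit interval
(`exists_standardization`), and the reflection `x ↦ 1 - x` exchanges `c` and `1 - c`
(`reflect_mem_csRegion_iff`), so `p` and `q` are needed only on `(0, c]`, where they are piecewise
affine. Integrating them and the square of their sum gives rational functions of `τ` and `c`
(`integral_outMean`, `integral_totalMean_sq`). Positivity of `ν` is read off after rewriting the
numerators in `c (1 - c) ≤ 1/4` (`csNu_pos`). -/

/-! ### Averages of a bounded kernel over pairs of i.i.d. variables: Hoeffding projection and limit
theorem. -/

section PairStatistics

variable {Ω E F : Type*} [MeasurableSpace Ω] [MeasurableSpace E] [MeasurableSpace F]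
  {P : Measure Ω} [IsProbabilityMeasure P]

lemma integrable_of_measurable_of_abs_le {f : Ω → ℝ} {C : ℝ} (hf : Measurable f)
    (hC : ∀ ω, |f ω| ≤ C) : Integrable f P :=
  .of_bound hf.aestronglyMeasurable C (.of_forall hC)

lemma abs_integral_le_of_abs_le {f : Ω → ℝ} {C : ℝ} (hC : ∀ ω, |f ω| ≤ C) :
    |∫ ω, f ω ∂P| ≤ C := by
  simpa using norm_integral_le_of_norm_le_const (μ := P) (f := f) (.of_forall hC)

/-- Integrating out one of two independent variables. -/
lemma integral_comp_pair {Y : Ω → E} {Z : Ω → F} (hY : Measurable Y) (hZ : Measurable Z)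
    (hYZ : IndepFun Y Z P) {Φ : E → F → ℝ} (hΦ : Measurable (Function.uncurry Φ)) {C : ℝ}
    (hC : ∀ y z, |Φ y z| ≤ C) :
    ∫ ω, Φ (Y ω) (Z ω) ∂P = ∫ ω, ∫ y, Φ y (Z ω) ∂(P.map Y) ∂P := by
  have : IsProbabilityMeasure (P.map Y) := Measure.isProbabilityMeasure_map hY.aemeasurable
  have : IsProbabilityMeasure (P.map Z) := Measure.isProbabilityMeasure_map hZ.aemeasurable
  have hΦ' : Measurable (Function.uncurry fun z y => Φ y z) := hΦ.comp measurable_swap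
  calc ∫ ω, Φ (Y ω) (Z ω) ∂P
      = ∫ x, Function.uncurry Φ x ∂(P.map fun ω => (Y ω, Z ω)) :=
        (integral_map (hY.prodMk hZ).aemeasurable hΦ.aestronglyMeasurable).symm
    _ = ∫ z, ∫ y, Φ y z ∂(P.map Y) ∂(P.map Z) := by
        rw [hYZ.map_prod_eq_prod_map_map hY.aemeasurable hZ.aemeasurable,
          integral_prod_symm _ (integrable_of_measurable_of_abs_le hΦ fun x => hC _ _)]
        rfl
    _ = ∫ ω, ∫ y, Φ y (Z ω) ∂(P.map Y) ∂P :=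
        integral_map hZ.aemeasurable hΦ'.stronglyMeasurable.integral_prod_right.aestronglyMeasurable

lemma integral_comp_pair_eq_zero {Y : Ω → E} {Z : Ω → F} (hY : Measurable Y) (hZ : Measurable Z)
    (hYZ : IndepFun Y Z P) {Φ : E → F → ℝ} (hΦ : Measurable (Function.uncurry Φ)) {C : ℝ}
    (hC : ∀ y z, |Φ y z| ≤ C) (h0 : ∀ z, ∫ y, Φ y z ∂(P.map Y) = 0) :
    ∫ ω, Φ (Y ω) (Z ω) ∂P = 0 := by
  simp [integral_comp_pair hY hZ hYZ hΦ hC, h0]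

variable {Y : ℕ → Ω → E} {m : Measure E}

lemma integral_comp_two (hY : ∀ i, Measurable (Y i)) (hind : iIndepFun Y P)
    (hm : ∀ i, P.map (Y i) = m) {h : E → E → ℝ} (hh : Measurable (Function.uncurry h)) {C : ℝ}
    (hC : ∀ x y, |h x y| ≤ C) {i j : ℕ} (hij : i ≠ j) :
    ∫ ω, h (Y i ω) (Y j ω) ∂P = ∫ x, ∫ y, h x y ∂m ∂m := by
  have : IsProbabilityMeasure m := hm 0 ▸ Measure.isProbabilityMeasure_map (hY 0).aemeasurable
  have hg : Measurable fun x => ∫ y, h x y ∂m :=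
    hh.stronglyMeasurable.integral_prod_right.measurable
  rw [integral_comp_pair (Φ := fun y x => h x y) (hY j) (hY i) (hind.indepFun hij.symm)
    (hh.comp measurable_swap) fun y x => hC x y, hm j]
  rw [← integral_map (hY i).aemeasurable hg.aestronglyMeasurable, hm i]

/-- The covariance of a kernel at two pairs which share one point is the variance of its
projection. -/
lemma covariance_comp_pairs (hY : ∀ i, Measurable (Y i)) (hind : iIndepFun Y P)
    (hm : ∀ i, P.map (Y i) = m) {h : E → E → ℝ} (hh : Measurable (Function.uncurry h)) {C : ℝ}
    (hC : ∀ x y, |h x y| ≤ C) {i j k : ℕ} (hij : i ≠ j) (hik : i ≠ k) (hjk : j ≠ k) :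
    cov[fun ω => h (Y i ω) (Y j ω), fun ω => h (Y i ω) (Y k ω); P]
      = Var[fun x => ∫ y, h x y ∂m; m] := by
  have : IsProbabilityMeasure m := hm 0 ▸ Measure.isProbabilityMeasure_map (hY 0).aemeasurable
  set g : E → ℝ := fun x => ∫ y, h x y ∂m with hg_def
  have hg : Measurable g := hh.stronglyMeasurable.integral_prod_right.measurable
  have hgC : ∀ x, |g x| ≤ C := fun x => abs_integral_le_of_abs_le (hC x)
  have hmem : ∀ l, MemLp (fun ω => h (Y i ω) (Y l ω)) 2 P := fun l =>
    MemLp.of_bound (hh.comp ((hY i).prodMk (hY l))).aestronglyMeasurable C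
      (.of_forall fun ω => hC _ _)
  have hmul : ∀ {a b : ℝ}, |a| ≤ C → |b| ≤ C → |a * b| ≤ C * C := fun {a b} ha hb => by
    rw [abs_mul]
    exact mul_le_mul ha hb (abs_nonneg _) ((abs_nonneg _).trans ha)
  -- Given `Y i`, the two factors are independent: averaging over `Y j` here and over `Y k` in `h2`
  -- replaces each by the projection `g`.
  have h1 : ∫ ω, h (Y i ω) (Y j ω) * h (Y i ω) (Y k ω) ∂P
      = ∫ ω, g (Y i ω) * h (Y i ω) (Y k ω) ∂P := by
    rw [integral_comp_pair (Y := Y j) (Z := fun ω => (Y i ω, Y k ω))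
      (Φ := fun y z => h z.1 y * h z.1 z.2) (hY j) ((hY i).prodMk (hY k))
      (hind.indepFun_prodMk hY i k j hij hjk.symm).symm
      ((hh.comp ((measurable_fst.comp measurable_snd).prodMk measurable_fst)).mul
        (hh.comp measurable_snd)) fun y z => hmul (hC _ _) (hC _ _), hm j]
    simp only [integral_mul_const, hg_def]
  have h2 : ∫ ω, g (Y i ω) * h (Y i ω) (Y k ω) ∂P = ∫ x, g x ^ 2 ∂m := by
    rw [integral_comp_two (h := fun x y => g x * h x y) hY hind hm
      ((hg.comp measurable_fst).mul hh) (fun x y => hmul (hgC _) (hC _ _)) hik]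
    simp only [integral_const_mul, hg_def, sq]
  rw [covariance_eq_sub (hmem j) (hmem k),
    variance_eq_sub (MemLp.of_bound hg.aestronglyMeasurable C (.of_forall hgC)),
    integral_comp_two hY hind hm hh hC hij, integral_comp_two hY hind hm hh hC hik, ← sq]
  simp only [Pi.mul_apply, Pi.pow_apply]
  rw [h1, h2]

/-- The index `i` occurs once only, so `Y i` is independent of all the other variables in the
product, and averaging over it first gives zero. The indices `j`, `k`, `l` may coincide, which is
why independence is taken between the families indexed by the finsets `{i}` and `{j, k, l}`. -/
lemma integral_mul_degenerate_eq_zero (hY : ∀ i, Measurable (Y i)) (hind : iIndepFun Y P)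
    (hm : ∀ i, P.map (Y i) = m) {r : E → E → ℝ} (hr : Measurable (Function.uncurry r)) {C : ℝ}
    (hC : ∀ x y, |r x y| ≤ C) (h0 : ∀ y, ∫ x, r x y ∂m = 0) {i j k l : ℕ}
    (hij : i ≠ j) (hik : i ≠ k) (hil : i ≠ l) :
    ∫ ω, r (Y i ω) (Y j ω) * r (Y k ω) (Y l ω) ∂P = 0 := by
  have hmi : i ∈ ({i} : Finset ℕ) := by simp
  have hmj : j ∈ ({j, k, l} : Finset ℕ) := by simp
  have hmk : k ∈ ({j, k, l} : Finset ℕ) := by simp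
  have hml : l ∈ ({j, k, l} : Finset ℕ) := by simp
  have hφ : Measurable fun f : ({i} : Finset ℕ) → E => f ⟨i, hmi⟩ := measurable_pi_apply _
  have hψ : Measurable fun f : ({j, k, l} : Finset ℕ) → E =>
      (f ⟨j, hmj⟩, f ⟨k, hmk⟩, f ⟨l, hml⟩) :=
    (measurable_pi_apply _).prodMk ((measurable_pi_apply _).prodMk (measurable_pi_apply _))
  have hI := (hind.indepFun_finset {i} {j, k, l} (by simp [hij, hik, hil]) hY).comp hφ hψ
  refine integral_comp_pair_eq_zero (Y := Y i) (Z := fun ω => (Y j ω, Y k ω, Y l ω))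
    (Φ := fun y z => r y z.1 * r z.2.1 z.2.2) (C := C * C) (hY i)
    ((hY j).prodMk ((hY k).prodMk (hY l))) hI ?_ (fun y z => ?_) fun z => ?_
  · exact (hr.comp (measurable_fst.prodMk (measurable_fst.comp measurable_snd))).mul
      (hr.comp ((measurable_fst.comp (measurable_snd.comp measurable_snd)).prodMk
        (measurable_snd.comp (measurable_snd.comp measurable_snd))))
  · rw [abs_mul]
    exact mul_le_mul (hC _ _) (hC _ _) (abs_nonneg _) ((abs_nonneg _).trans (hC y z.1))
  · rw [integral_mul_const, hm, h0, zero_mul]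

/-- The second moment of a sum over pairs of a bounded, completely degenerate kernel is of the
order of the number of pairs. -/
lemma integral_sq_sum_degenerate_le (hY : ∀ i, Measurable (Y i)) (hind : iIndepFun Y P)
    (hm : ∀ i, P.map (Y i) = m) {r : E → E → ℝ} (hr : Measurable (Function.uncurry r)) {C : ℝ}
    (hC : ∀ x y, |r x y| ≤ C) (h1 : ∀ y, ∫ x, r x y ∂m = 0) (h2 : ∀ x, ∫ y, r x y ∂m = 0)
    (s : Finset ℕ) :
    ∫ ω, (∑ p ∈ s.offDiag, r (Y p.1 ω) (Y p.2 ω)) ^ 2 ∂P ≤ 2 * C ^ 2 * s.offDiag.card := by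
  have hrm : ∀ p : ℕ × ℕ, Measurable fun ω => r (Y p.1 ω) (Y p.2 ω) :=
    fun p => hr.comp ((hY _).prodMk (hY _))
  have hbd : ∀ (p q : ℕ × ℕ) (ω : Ω),
      |r (Y p.1 ω) (Y p.2 ω) * r (Y q.1 ω) (Y q.2 ω)| ≤ C ^ 2 := fun p q ω => by
    rw [abs_mul, sq]
    exact mul_le_mul (hC _ _) (hC _ _) (abs_nonneg _)
      ((abs_nonneg _).trans (hC (Y p.1 ω) (Y p.2 ω)))
  have hint : ∀ p q : ℕ × ℕ,
      Integrable (fun ω => r (Y p.1 ω) (Y p.2 ω) * r (Y q.1 ω) (Y q.2 ω)) P := fun p q =>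
    integrable_of_measurable_of_abs_le ((hrm p).mul (hrm q)) (hbd p q)
  -- If `q` is neither `p` nor its swap, some index of `p` is absent from `q`. Should it be the
  -- second one, the lemma is applied to the transposed kernel.
  have hzero : ∀ p ∈ s.offDiag, ∀ q ∈ s.offDiag, q ≠ p → q ≠ p.swap →
      ∫ ω, r (Y p.1 ω) (Y p.2 ω) * r (Y q.1 ω) (Y q.2 ω) ∂P = 0 := by
    rintro ⟨i, j⟩ hp ⟨k, l⟩ hq h h'
    have hij : i ≠ j := (Finset.mem_offDiag.1 hp).2.2
    have hkl : k ≠ l := (Finset.mem_offDiag.1 hq).2.2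
    by_cases hi : i ≠ k ∧ i ≠ l
    · exact integral_mul_degenerate_eq_zero hY hind hm hr hC h1 hij hi.1 hi.2
    · have hj : j ≠ k ∧ j ≠ l := by
        simp only [Prod.swap_prod_mk, ne_eq, Prod.mk.injEq] at h h'
        grind
      have hr' : Measurable (Function.uncurry fun x y => r y x) := hr.comp measurable_swap
      exact integral_mul_degenerate_eq_zero (r := fun x y => r y x) hY hind hm hr'
        (fun x y => hC y x) h2 hij.symm hj.2 hj.1
  calc ∫ ω, (∑ p ∈ s.offDiag, r (Y p.1 ω) (Y p.2 ω)) ^ 2 ∂P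
      = ∑ p ∈ s.offDiag, ∑ q ∈ s.offDiag,
          ∫ ω, r (Y p.1 ω) (Y p.2 ω) * r (Y q.1 ω) (Y q.2 ω) ∂P := by
        simp_rw [sq, Finset.sum_mul_sum]
        rw [integral_finsetSum _ fun p _ => integrable_finsetSum _ fun q _ => hint p q]
        exact Finset.sum_congr rfl fun p _ => integral_finsetSum _ fun q _ => hint p q
    -- For fixed `p` only `q = p` and `q = p.swap` survive, each contributing at most `C ^ 2`.
    _ ≤ ∑ p ∈ s.offDiag, 2 * C ^ 2 := by
        refine Finset.sum_le_sum fun p hp => ?_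
        have hsub : ({p, p.swap} : Finset (ℕ × ℕ)) ⊆ s.offDiag := by
          intro q hq
          simp only [Finset.mem_insert, Finset.mem_singleton] at hq
          rcases hq with rfl | rfl
          · exact hp
          · simp only [Finset.mem_offDiag, Prod.fst_swap, Prod.snd_swap] at hp ⊢
            exact ⟨hp.2.1, hp.1, hp.2.2.symm⟩
        rw [← Finset.sum_subset hsub fun q hq hq' => by
          simp only [Finset.mem_insert, Finset.mem_singleton, not_or] at hq'
          exact hzero p hp q hq hq'.1 hq'.2]
        have hne : p ≠ p.swap := fun h =>
          (Finset.mem_offDiag.1 hp).2.2 (congrArg Prod.fst h)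
        rw [Finset.sum_pair hne, two_mul]
        exact add_le_add ((le_abs_self _).trans (abs_integral_le_of_abs_le (hbd _ _)))
          ((le_abs_self _).trans (abs_integral_le_of_abs_le (hbd _ _)))
    _ = 2 * C ^ 2 * s.offDiag.card := by rw [Finset.sum_const, nsmul_eq_mul, mul_comm]

/-- Each index is the first entry of `s.card - 1` off-diagonal pairs. -/
lemma sum_offDiag_fst (s : Finset ℕ) (f : ℕ → ℝ) :
    ∑ p ∈ s.offDiag, f p.1 = ((s.card : ℝ) - 1) * ∑ i ∈ s, f i := by
  have h : ∑ p ∈ s.diag, f p.1 + ∑ p ∈ s.offDiag, f p.1 = s.card * ∑ i ∈ s, f i := by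
    rw [← Finset.sum_union (Finset.disjoint_diag_offDiag s), Finset.diag_union_offDiag,
      Finset.sum_product, Finset.mul_sum]
    simp
  rw [Finset.sum_diag] at h
  linarith

lemma sum_offDiag_snd (s : Finset ℕ) (f : ℕ → ℝ) :
    ∑ p ∈ s.offDiag, f p.2 = ((s.card : ℝ) - 1) * ∑ i ∈ s, f i := by
  rw [← sum_offDiag_fst]
  refine Finset.sum_nbij' Prod.swap Prod.swap ?_ ?_ ?_ ?_ ?_ <;>
    simp +contextual [Finset.mem_offDiag, eq_comm]

lemma card_offDiag_range (n : ℕ) :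
    ((Finset.range n).offDiag.card : ℝ) = (n : ℝ) * ((n : ℝ) - 1) := by
  rw [Finset.offDiag_card, Finset.card_range, Nat.cast_sub (Nat.le_mul_self n)]
  push_cast; ring

/-- The completely degenerate part of a statistic over pairs is negligible at the scale `√n`. -/
lemma tendstoInMeasure_sum_degenerate (hY : ∀ i, Measurable (Y i)) (hind : iIndepFun Y P)
    (hm : ∀ i, P.map (Y i) = m) {r : E → E → ℝ} (hr : Measurable (Function.uncurry r)) {C : ℝ}
    (hC : ∀ x y, |r x y| ≤ C) (h1 : ∀ y, ∫ x, r x y ∂m = 0) (h2 : ∀ x, ∫ y, r x y ∂m = 0) :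
    TendstoInMeasure P
      (fun (n : ℕ) ω => Real.sqrt n * (∑ p ∈ (Finset.range n).offDiag, r (Y p.1 ω) (Y p.2 ω))
        / ((n : ℝ) * ((n : ℝ) - 1))) atTop 0 := by
  set R : ℕ → Ω → ℝ := fun n ω => ∑ p ∈ (Finset.range n).offDiag, r (Y p.1 ω) (Y p.2 ω) with hR
  have hRm : ∀ n, Measurable (R n) := fun n =>
    Finset.measurable_fun_sum _ fun p _ => hr.comp ((hY p.1).prodMk (hY p.2))
  rw [tendstoInMeasure_iff_measureReal_norm]
  intro ε hε
  -- Markov's inequality for the square: the second moment is at most `2 C² n (n - 1)`, and the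
  -- factor `n / (n (n - 1))²` turns it into `2 C² / (n - 1)`.
  have hbound : ∀ n : ℕ, 2 ≤ n →
      P.real {ω | ε ≤ ‖Real.sqrt n * R n ω / ((n : ℝ) * ((n : ℝ) - 1)) - (0 : Ω → ℝ) ω‖}
        ≤ (2 * C ^ 2 / ε ^ 2) / ((n : ℝ) - 1) := by
    intro n hn
    have hn' : (2 : ℝ) ≤ n := by exact_mod_cast hn
    have hn0 : (n : ℝ) ≠ 0 := by positivity
    have hn1 : (0 : ℝ) < (n : ℝ) - 1 := by linarith
    have hRb : ∀ ω, |R n ω ^ 2| ≤ ((Finset.range n).offDiag.card * C) ^ 2 := fun ω => by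
      rw [abs_pow]
      refine pow_le_pow_left₀ (abs_nonneg _) ((Finset.abs_sum_le_sum_abs _ _).trans ?_) 2
      rw [← nsmul_eq_mul]
      exact Finset.sum_le_card_nsmul _ _ _ fun p _ => hC _ _
    have hset : {ω | ε ≤ ‖Real.sqrt n * R n ω / ((n : ℝ) * ((n : ℝ) - 1)) - (0 : Ω → ℝ) ω‖}
        = {ω | ε ^ 2 ≤ (n : ℝ) / ((n : ℝ) * ((n : ℝ) - 1)) ^ 2 * R n ω ^ 2} := by
      ext ω
      have hsq : (n : ℝ) / ((n : ℝ) * ((n : ℝ) - 1)) ^ 2 * R n ω ^ 2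
          = (Real.sqrt n * R n ω / ((n : ℝ) * ((n : ℝ) - 1))) ^ 2 := by
        rw [div_pow (_ * R n ω), mul_pow _ (R n ω), Real.sq_sqrt (Nat.cast_nonneg n)]; ring
      rw [mem_ofPred_eq, mem_ofPred_eq, hsq, sq_le_sq, abs_of_pos hε, Pi.zero_apply, sub_zero,
        Real.norm_eq_abs]
    have hmark := mul_meas_ge_le_integral_of_nonneg (μ := P)
      (f := fun ω => (n : ℝ) / ((n : ℝ) * ((n : ℝ) - 1)) ^ 2 * R n ω ^ 2)
      (.of_forall fun ω => by positivity)
      ((integrable_of_measurable_of_abs_le ((hRm n).pow_const 2) hRb).const_mul _) (ε ^ 2)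
    have hmom := integral_sq_sum_degenerate_le hY hind hm hr hC h1 h2 (Finset.range n)
    rw [card_offDiag_range] at hmom
    rw [integral_const_mul] at hmark
    have h3 : (n : ℝ) / ((n : ℝ) * ((n : ℝ) - 1)) ^ 2 * ∫ ω, R n ω ^ 2 ∂P
        ≤ 2 * C ^ 2 / ((n : ℝ) - 1) := by
      refine (mul_le_mul_of_nonneg_left hmom (by positivity)).trans_eq ?_
      field_simp
    rw [hset, div_right_comm, le_div_iff₀ (by positivity), mul_comm]
    exact hmark.trans h3
  have hlim : Tendsto (fun n : ℕ => (2 * C ^ 2 / ε ^ 2) / ((n : ℝ) - 1)) atTop (nhds 0) :=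
    tendsto_const_nhds.div_atTop
      (tendsto_atTop_add_const_right _ (-1) tendsto_natCast_atTop_atTop)
  refine squeeze_zero' (.of_forall fun n => measureReal_nonneg) ?_ hlim
  filter_upwards [eventually_ge_atTop 2] with n hn using hbound n hn

/-- **Central limit theorem** for the average of a bounded kernel over all ordered pairs of
independent identically distributed variables. -/
theorem tendstoInDistribution_average_offDiag [IsProbabilityMeasure m]
    (hY : ∀ i, Measurable (Y i)) (hind : iIndepFun Y P)
    (hm : ∀ i, P.map (Y i) = m) {a : E → E → ℝ} (ha : Measurable (Function.uncurry a)) {C : ℝ}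
    (hC : ∀ x y, |a x y| ≤ C) :
    TendstoInDistribution
      (fun (n : ℕ) ω => Real.sqrt n *
        ((∑ p ∈ (Finset.range n).offDiag, a (Y p.1 ω) (Y p.2 ω)) / ((n : ℝ) * ((n : ℝ) - 1))
          - ∫ x, ∫ y, a x y ∂m ∂m))
      atTop (id : ℝ → ℝ) (fun _ => P)
      (gaussianReal 0 (Var[fun x => ∫ y, a x y ∂m + ∫ y, a y x ∂m; m]).toNNReal) := by
  set p : E → ℝ := fun x => ∫ y, a x y ∂m with hp
  set q : E → ℝ := fun x => ∫ y, a y x ∂m with hq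
  set μ : ℝ := ∫ x, p x ∂m with hμ
  have ha' : Measurable (Function.uncurry fun x y => a y x) := ha.comp measurable_swap
  have hpm : Measurable p := ha.stronglyMeasurable.integral_prod_right.measurable
  have hqm : Measurable q := ha'.stronglyMeasurable.integral_prod_right.measurable
  have hpC : ∀ x, |p x| ≤ C := fun x => abs_integral_le_of_abs_le (hC x)
  have hqC : ∀ x, |q x| ≤ C := fun x => abs_integral_le_of_abs_le fun y => hC y x
  have hμC : |μ| ≤ C := abs_integral_le_of_abs_le hpC
  have hqμ : ∫ x, q x ∂m = μ :=
    integral_integral_swap (f := fun x y => a y x)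
      (integrable_of_measurable_of_abs_le ha' fun x => hC _ _)
  have hpi : Integrable p m := integrable_of_measurable_of_abs_le hpm hpC
  have hqi : Integrable q m := integrable_of_measurable_of_abs_le hqm hqC
  set H : E → ℝ := fun x => p x + q x with hH
  have hHm : Measurable H := hpm.add hqm
  have hHC : ∀ x, |H x| ≤ C + C := fun x =>
    (abs_add_le _ _).trans (add_le_add (hpC x) (hqC x))
  have hHμ : ∫ x, H x ∂m = 2 * μ := by rw [integral_add hpi hqi, hqμ]; ring
  -- The degenerate remainder of Hoeffding's decomposition; `μ` is added back because `p` and `q`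
  -- both carry it.
  set r : E → E → ℝ := fun x y => a x y - p x - q y + μ with hr
  have hrm : Measurable (Function.uncurry r) :=
    ((ha.sub (hpm.comp measurable_fst)).sub (hqm.comp measurable_snd)).add_const μ
  have hrC : ∀ x y, |r x y| ≤ 4 * C := fun x y => by
    have h1 := abs_le.1 (hC x y)
    have h2 := abs_le.1 (hpC x)
    have h3 := abs_le.1 (hqC y)
    have h4 := abs_le.1 hμC
    exact abs_le.2 ⟨by simp only [hr]; linarith, by simp only [hr]; linarith⟩
  have hai : ∀ x, Integrable (a x) m := fun x =>
    integrable_of_measurable_of_abs_le (ha.comp measurable_prodMk_left) (hC x)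
  have hai' : ∀ y, Integrable (fun x => a x y) m := fun y =>
    integrable_of_measurable_of_abs_le (ha.comp measurable_prodMk_right) fun x => hC x y
  have hr1 : ∀ y, ∫ x, r x y ∂m = 0 := fun y => by
    have h1 : Integrable (fun x => a x y - p x) m := (hai' y).sub hpi
    have h2 : Integrable (fun x => a x y - p x - q y) m := h1.sub (integrable_const _)
    simp only [hr]
    rw [integral_add h2 (integrable_const _), integral_sub h1 (integrable_const _),
      integral_sub (hai' y) hpi]
    simp [hq, hμ]
  have hr2 : ∀ x, ∫ y, r x y ∂m = 0 := fun x => by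
    have h1 : Integrable (fun y => a x y - p x) m := (hai x).sub (integrable_const _)
    have h2 : Integrable (fun y => a x y - p x - q y) m := h1.sub hqi
    simp only [hr]
    rw [integral_add h2 (integrable_const _), integral_sub h1 hqi,
      integral_sub (hai x) (integrable_const _), hqμ]
    simp [hp]
  have hident : ∀ i, IdentDistrib (fun ω => H (Y i ω)) (fun ω => H (Y 0 ω)) P P := fun i =>
    (IdentDistrib.mk (hY i).aemeasurable (hY 0).aemeasurable (by rw [hm, hm])).comp hHm
  have hE0 : ∫ ω, H (Y 0 ω) ∂P = 2 * μ := by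
    rw [← hHμ, ← hm 0, integral_map (hY 0).aemeasurable hHm.aestronglyMeasurable]
  have hV0 : Var[fun ω => H (Y 0 ω); P] = Var[H; m] := by
    rw [← hm 0, variance_map hHm.aemeasurable (hY 0).aemeasurable]
    rfl
  have hclt := tendstoInDistribution_inv_sqrt_mul_sum_sub (P := P)
    (P' := gaussianReal 0 (Var[H; m]).toNNReal) (X := fun i ω => H (Y i ω)) (Y := id)
    (by rw [hV0]; exact HasLaw.id)
    (MemLp.of_bound (hHm.comp (hY 0)).aestronglyMeasurable (C + C) (.of_forall fun ω => hHC _))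
    (hind.comp (fun _ => H) fun _ => hHm) hident
  simp only [hE0] at hclt
  have hsum : ∀ n : ℕ,
      Measurable fun ω => ∑ p ∈ (Finset.range n).offDiag, a (Y p.1 ω) (Y p.2 ω) := fun n =>
    Finset.measurable_fun_sum _ fun (p : ℕ × ℕ) _ => ha.comp ((hY p.1).prodMk (hY p.2))
  -- Slutsky: it suffices that the statistic differs from the normalized sum of the `H (Y k)` by a
  -- term that vanishes in probability. By `hdecomp` this term is exactly the degenerate part once
  -- `n ≥ 2`.
  refine tendstoInDistribution_of_tendstoInMeasure_sub _ _ hclt ?_ fun n =>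
    ((((hsum n).div_const _).sub_const _).const_mul _).aemeasurable
  set R : ℕ → Ω → ℝ := fun n ω => ∑ p ∈ (Finset.range n).offDiag, r (Y p.1 ω) (Y p.2 ω) with hR
  have hdecomp : ∀ n : ℕ, 2 ≤ n → ∀ ω,
      Real.sqrt n * ((∑ p ∈ (Finset.range n).offDiag, a (Y p.1 ω) (Y p.2 ω))
        / ((n : ℝ) * ((n : ℝ) - 1)) - μ)
        - (Real.sqrt n)⁻¹ * (∑ k ∈ Finset.range n, H (Y k ω) - n * (2 * μ))
        = Real.sqrt n * R n ω / ((n : ℝ) * ((n : ℝ) - 1)) := by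
    intro n hn ω
    have hn' : (2 : ℝ) ≤ n := by exact_mod_cast hn
    have hRn : R n ω = (∑ p ∈ (Finset.range n).offDiag, a (Y p.1 ω) (Y p.2 ω))
        - ((n : ℝ) - 1) * ∑ k ∈ Finset.range n, H (Y k ω) + n * (n - 1) * μ := by
      simp only [hR, hr, hH, Finset.sum_add_distrib, Finset.sum_sub_distrib, Finset.sum_const,
        nsmul_eq_mul, card_offDiag_range]
      rw [sum_offDiag_fst _ fun i => p (Y i ω), sum_offDiag_snd _ fun i => q (Y i ω),
        Finset.card_range]
      ring
    have hs : (Real.sqrt n)⁻¹ = Real.sqrt n / n := by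
      rw [Real.sqrt_div_self', one_div]
    have hn0 : (n : ℝ) ≠ 0 := by positivity
    have hn1 : (n : ℝ) - 1 ≠ 0 := by linarith
    rw [hs, hRn]
    field_simp
    ring
  refine (tendstoInMeasure_sum_degenerate hY hind hm hrm hrC hr1 hr2).congr' ?_ .rfl
  filter_upwards [eventually_ge_atTop 2] with n hn
  exact .of_forall fun ω => (hdecomp n hn ω).symm

end PairStatistics

/-! ### The proximity region on the unit interval: symmetries and conditional arc probabilities. -/

section Region

/-- Each end of the region is `x` shifted by a multiple of its distance to an endpoint, so the
construction commutes with increasing affine maps. -/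
lemma affine_mem_csRegion_iff {y₁ y₂ : ℝ} (hy : y₁ < y₂) (τ c x y : ℝ) :
    y₁ + (y₂ - y₁) * y ∈ csRegion y₁ y₂ τ c (y₁ + (y₂ - y₁) * x) ↔ y ∈ csRegion 0 1 τ c x := by
  have hd : 0 < y₂ - y₁ := sub_pos.2 hy
  obtain ⟨d, hd', rfl⟩ : ∃ d, 0 < d ∧ y₂ = y₁ + d := ⟨_, hd, by ring⟩
  simp only [add_sub_cancel_left, csRegion]
  have e0 : y₁ + d * x = y₁ ↔ x = 0 := by simp [hd'.ne']
  have e1 : y₁ + d * x = y₁ + d ↔ x = 1 := by simp [hd'.ne']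
  have e2 : y₁ + d * x ≤ y₁ + c * d ↔ x ≤ 0 + c * (1 - 0) := by
    rw [add_le_add_iff_left, mul_comm c, mul_le_mul_iff_right₀ hd']; simp
  have e3 : y₁ + d * y = y₁ + d * x ↔ y = x := by simp [hd'.ne']
  have key : ∀ u v : ℝ, y₁ + d * u < y₁ + d * v ↔ u < v := fun u v => by
    rw [add_lt_add_iff_left, mul_lt_mul_iff_right₀ hd']
  have k0 : y₁ < y₁ + d * y ↔ 0 < y := by simp [hd']
  have k1 : y₁ + d * y < y₁ + d ↔ y < 1 := by simpa using key y 1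
  simp only [e0, e1, e2]
  split_ifs
  · simp [e3]
  · simp only [mem_inter_iff, mem_Ioo, k0, k1]
    rw [show y₁ + d * x - τ * (d * x) = y₁ + d * (x - τ * (x - 0)) by ring, key,
      show y₁ + d * x + τ * (1 - c) * (d * x) / c
        = y₁ + d * (x + τ * (1 - c) * (x - 0) / c) by ring, key]
  · simp only [mem_inter_iff, mem_Ioo, k0, k1]
    rw [show y₁ + d * x - c * τ * (y₁ + d - (y₁ + d * x)) / (1 - c)
        = y₁ + d * (x - c * τ * (1 - x) / (1 - c)) by ring, key,
      show y₁ + d * x + τ * (y₁ + d - (y₁ + d * x)) = y₁ + d * (x + τ * (1 - x)) by ring, key]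

lemma mem_csRegion_left {τ c x y : ℝ} (hc : 0 < c) (hx0 : 0 < x) (hx1 : x < 1) (hxc : x ≤ c) :
    y ∈ csRegion 0 1 τ c x ↔
      (x * (1 - τ) < y ∧ y < x * (c + τ * (1 - c)) / c) ∧ 0 < y ∧ y < 1 := by
  have h1 : x - τ * (x - 0) = x * (1 - τ) := by ring
  have h2 : x + τ * (1 - c) * (x - 0) / c = x * (c + τ * (1 - c)) / c := by field_simp; ring
  rw [csRegion, if_neg (by rintro (h | h) <;> linarith), if_pos (by simpa using hxc), h1, h2]
  simp only [mem_inter_iff, mem_Ioo]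

/-- Written in `1 - x` and `1 - y`, so that it has the form of `mem_csRegion_left` with `1 - c` for
`c`. -/
lemma mem_csRegion_right {τ c x y : ℝ} (hc : c < 1) (hx0 : 0 < x) (hx1 : x < 1) (hxc : c < x) :
    y ∈ csRegion 0 1 τ c x ↔
      ((1 - x) * (1 - τ) < 1 - y ∧ 1 - y < (1 - x) * (1 - c + c * τ) / (1 - c)) ∧
        0 < y ∧ y < 1 := by
  have hc' : 1 - c ≠ 0 := (sub_pos.2 hc).ne'
  have h1 : x - c * τ * (1 - x) / (1 - c) = 1 - (1 - x) * (1 - c + c * τ) / (1 - c) := by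
    field_simp; ring
  have h2 : x + τ * (1 - x) = 1 - (1 - x) * (1 - τ) := by ring
  rw [csRegion, if_neg (by rintro (h | h) <;> linarith), if_neg (by simpa using hxc), h1, h2]
  simp only [mem_inter_iff, mem_Ioo, and_congr_left_iff]
  intro _
  constructor <;> rintro ⟨h, h'⟩ <;> constructor <;> linarith

/-- Reflection of the unit interval exchanges the centrality parameters `c` and `1 - c`. -/
lemma reflect_mem_csRegion_iff {τ c x y : ℝ} (hc0 : 0 < c) (hc1 : c < 1) (hx : x ∈ Ioo (0 : ℝ) 1) :
    1 - y ∈ csRegion 0 1 τ (1 - c) (1 - x) ↔ y ∈ csRegion 0 1 τ c x := by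
  obtain ⟨hx0, hx1⟩ := hx
  rcases lt_trichotomy x c with h | rfl | h
  · rw [mem_csRegion_left hc0 hx0 hx1 h.le,
      mem_csRegion_right (by linarith) (by linarith) (by linarith) (by linarith)]
    simp only [sub_sub_cancel, sub_pos, sub_lt_self_iff]
    rw [show c + (1 - c) * τ = c + τ * (1 - c) by ring, and_comm (a := y < 1)]
  -- At the centre `x = c` both the point and its reflection fall under the left-hand formula, so
  -- the two intervals are compared directly.
  · rw [mem_csRegion_left hc0 hx0 hx1 le_rfl,
      mem_csRegion_left (by linarith) (by linarith) (by linarith) le_rfl]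
    have hx1' : 1 - x ≠ 0 := by linarith
    rw [mul_div_cancel_left₀ _ hx0.ne', mul_div_cancel_left₀ _ hx1']
    constructor <;> rintro ⟨⟨h1, h2⟩, h3, h4⟩ <;> refine ⟨⟨?_, ?_⟩, ?_, ?_⟩ <;> nlinarith
  · rw [mem_csRegion_right hc1 hx0 hx1 h,
      mem_csRegion_left (by linarith) (by linarith) (by linarith) (by linarith)]
    simp only [sub_sub_cancel, sub_pos, sub_lt_self_iff]
    rw [show 1 - c + τ * c = 1 - c + c * τ by ring, and_comm (a := y < 1)]

lemma measurableSet_csRegion (y₁ y₂ τ c : ℝ) :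
    MeasurableSet {p : ℝ × ℝ | p.2 ∈ csRegion y₁ y₂ τ c p.1} := by
  have h : {p : ℝ × ℝ | p.2 ∈ csRegion y₁ y₂ τ c p.1}
      = ({p | p.1 = y₁} ∪ {p | p.1 = y₂}).ite {p | p.2 = p.1}
        ({p | p.1 ≤ y₁ + c * (y₂ - y₁)}.ite
          ({p | p.1 - τ * (p.1 - y₁) < p.2} ∩ {p | p.2 < p.1 + τ * (1 - c) * (p.1 - y₁) / c} ∩
            {p | p.2 ∈ Ioo y₁ y₂})
          ({p | p.1 - c * τ * (y₂ - p.1) / (1 - c) < p.2} ∩ {p | p.2 < p.1 + τ * (y₂ - p.1)} ∩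
            {p | p.2 ∈ Ioo y₁ y₂})) := by
    ext ⟨x, y⟩
    simp only [csRegion, Set.ite, mem_ofPred_eq, mem_union, mem_inter_iff, Set.mem_sdiff]
    split_ifs <;> simp_all [and_assoc]
  have hIoo : MeasurableSet {p : ℝ × ℝ | p.2 ∈ Ioo y₁ y₂} := measurable_snd measurableSet_Ioo
  rw [h]
  refine MeasurableSet.ite ?_ (measurableSet_eq_fun measurable_snd measurable_fst)
    (MeasurableSet.ite (measurableSet_le measurable_fst measurable_const) ?_ ?_)
  · exact (measurableSet_eq_fun measurable_fst measurable_const).union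
      (measurableSet_eq_fun measurable_fst measurable_const)
  · exact ((measurableSet_lt (by fun_prop) (by fun_prop)).inter
      (measurableSet_lt (by fun_prop) (by fun_prop))).inter hIoo
  · exact ((measurableSet_lt (by fun_prop) (by fun_prop)).inter
      (measurableSet_lt (by fun_prop) (by fun_prop))).inter hIoo

/-- The indicator of an arc from `x` to `y` in the unit interval. -/
noncomputable def unitArc (τ c x y : ℝ) : ℝ :=
  (csRegion 0 1 τ c x).indicator (fun _ => (1 : ℝ)) y

lemma measurable_unitArc (τ c : ℝ) : Measurable (Function.uncurry (unitArc τ c)) := by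
  have h : Function.uncurry (unitArc τ c)
      = {p : ℝ × ℝ | p.2 ∈ csRegion 0 1 τ c p.1}.indicator fun _ => (1 : ℝ) := by
    ext ⟨x, y⟩
    simp [unitArc, Set.indicator, Function.uncurry]
  rw [h]
  exact measurable_const.indicator (measurableSet_csRegion 0 1 τ c)

lemma abs_unitArc_le (τ c x y : ℝ) : |unitArc τ c x y| ≤ 1 := by
  by_cases h : y ∈ csRegion 0 1 τ c x <;> simp [unitArc, h]

/-- The uniform distribution on the unit interval. -/
noncomputable def unitUniform : Measure ℝ := volume.restrict (Ioo 0 1)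

instance : IsProbabilityMeasure unitUniform := ⟨by simp [unitUniform]⟩

lemma integral_unitUniform (f : ℝ → ℝ) : ∫ x, f x ∂unitUniform = ∫ x in (0 : ℝ)..1, f x := by
  rw [unitUniform, intervalIntegral.integral_of_le zero_le_one, integral_Ioc_eq_integral_Ioo]

lemma integral_indicator_unitUniform {s : Set ℝ} (hs : MeasurableSet s) :
    ∫ x, s.indicator (fun _ => (1 : ℝ)) x ∂unitUniform = volume.real (s ∩ Ioo 0 1) := by
  rw [integral_indicator_const _ hs, smul_eq_mul, mul_one, unitUniform,
    measureReal_restrict_apply hs]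

/-- The expected proportion of points which receive an arc from `x`. -/
noncomputable def outMean (τ c x : ℝ) : ℝ := ∫ y, unitArc τ c x y ∂unitUniform

/-- The expected proportion of points which send an arc to `x`. -/
noncomputable def inMean (τ c x : ℝ) : ℝ := ∫ y, unitArc τ c y x ∂unitUniform

lemma outMean_eq_measureReal (τ c x : ℝ) :
    outMean τ c x = volume.real (csRegion 0 1 τ c x ∩ Ioo 0 1) :=
  integral_indicator_unitUniform (measurable_prodMk_left (measurableSet_csRegion 0 1 τ c))

lemma inMean_eq_measureReal (τ c y : ℝ) :
    inMean τ c y = volume.real ({x | y ∈ csRegion 0 1 τ c x} ∩ Ioo 0 1) := by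
  have h : MeasurableSet {x | y ∈ csRegion 0 1 τ c x} :=
    measurable_prodMk_right (measurableSet_csRegion 0 1 τ c)
  exact integral_indicator_unitUniform h

lemma measurable_outMean (τ c : ℝ) : Measurable (outMean τ c) :=
  (measurable_unitArc τ c).stronglyMeasurable.integral_prod_right.measurable

lemma measurable_inMean (τ c : ℝ) : Measurable (inMean τ c) := by
  have h : Measurable (Function.uncurry fun x y => unitArc τ c y x) :=
    (measurable_unitArc τ c).comp measurable_swap
  exact h.stronglyMeasurable.integral_prod_right.measurable

lemma abs_outMean_le (τ c x : ℝ) : |outMean τ c x| ≤ 1 :=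
  abs_integral_le_of_abs_le (abs_unitArc_le τ c x)

lemma abs_inMean_le (τ c x : ℝ) : |inMean τ c x| ≤ 1 :=
  abs_integral_le_of_abs_le fun y => abs_unitArc_le τ c y x

lemma unitArc_reflect {τ c x : ℝ} (hc0 : 0 < c) (hc1 : c < 1) (hx : x ∈ Ioo (0 : ℝ) 1) (y : ℝ) :
    unitArc τ (1 - c) (1 - x) (1 - y) = unitArc τ c x y := by
  have h := reflect_mem_csRegion_iff (τ := τ) (y := y) hc0 hc1 hx
  by_cases hy : y ∈ csRegion 0 1 τ c x <;> simp [unitArc, h, hy]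

lemma outMean_reflect {τ c x : ℝ} (hc0 : 0 < c) (hc1 : c < 1) (hx : x ∈ Ioo (0 : ℝ) 1) :
    outMean τ (1 - c) (1 - x) = outMean τ c x := by
  have h := intervalIntegral.integral_comp_sub_left (a := 0) (b := 1)
    (fun y => unitArc τ (1 - c) (1 - x) y) 1
  rw [outMean, outMean, integral_unitUniform, integral_unitUniform]
  simp only [sub_zero, sub_self, unitArc_reflect hc0 hc1 hx] at h
  exact h.symm

lemma inMean_reflect {τ c : ℝ} (hc0 : 0 < c) (hc1 : c < 1) (x : ℝ) :
    inMean τ (1 - c) (1 - x) = inMean τ c x := by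
  have h := intervalIntegral.integral_comp_sub_left (a := 0) (b := 1)
    (fun y => unitArc τ (1 - c) y (1 - x)) 1
  simp only [sub_zero, sub_self] at h
  rw [inMean, inMean, integral_unitUniform, ← h, ← integral_unitUniform, unitUniform]
  exact setIntegral_congr_fun measurableSet_Ioo fun y hy => unitArc_reflect hc0 hc1 hy x

/-- For `τ < 1` the region is not truncated by the endpoints, and its length is `τ x + τ (1 - c) x /
c`. -/
lemma outMean_of_lt_one {τ c x : ℝ} (hτ0 : 0 < τ) (hτ : τ < 1) (hc0 : 0 < c) (hc1 : c < 1)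
    (hx0 : 0 < x) (hxc : x ≤ c) : outMean τ c x = τ / c * x := by
  have hset : csRegion 0 1 τ c x ∩ Ioo 0 1
      = Ioo (x * (1 - τ)) (x * (c + τ * (1 - c)) / c) := by
    ext y
    rw [mem_inter_iff, mem_csRegion_left hc0 hx0 (hxc.trans_lt hc1) hxc, mem_Ioo, mem_Ioo]
    have h1 : 0 < x * (1 - τ) := mul_pos hx0 (by linarith)
    have h2 : x * (c + τ * (1 - c)) / c ≤ 1 := by
      rw [div_le_one hc0]; nlinarith
    constructor
    · exact fun h => h.1.1
    · exact fun h => ⟨⟨h, by linarith [h.1], by linarith [h.2]⟩, by linarith [h.1], by linarith [h.2]⟩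
  have h3 : x * (1 - τ) ≤ x * (c + τ * (1 - c)) / c := by
    rw [le_div_iff₀ hc0]; nlinarith [mul_pos hx0 hτ0]
  rw [outMean_eq_measureReal, hset, Real.volume_real_Ioo_of_le h3]
  field_simp
  ring

/-- For `τ ≥ 1` the left end is cut off at `0`, and the right end possibly at `1`. -/
lemma outMean_of_one_le {τ c x : ℝ} (hτ : 1 ≤ τ) (hc0 : 0 < c) (hc1 : c < 1)
    (hx0 : 0 < x) (hxc : x ≤ c) : outMean τ c x = min 1 (x * (c + τ * (1 - c)) / c) := by
  have hset : csRegion 0 1 τ c x ∩ Ioo 0 1 = Ioo 0 (min 1 (x * (c + τ * (1 - c)) / c)) := by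
    ext y
    rw [mem_inter_iff, mem_csRegion_left hc0 hx0 (hxc.trans_lt hc1) hxc, mem_Ioo, mem_Ioo,
      lt_min_iff]
    have h1 : x * (1 - τ) ≤ 0 := mul_nonpos_of_nonneg_of_nonpos hx0.le (by linarith)
    constructor
    · exact fun h => ⟨h.1.2.1, h.1.2.2, h.1.1.2⟩
    · exact fun h => ⟨⟨⟨by linarith [h.1], h.2.2⟩, h.1, h.2.1⟩, h.1, h.2.1⟩
  have h3 : 0 ≤ min 1 (x * (c + τ * (1 - c)) / c) := by
    have : 0 < c + τ * (1 - c) := by nlinarith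
    exact le_min zero_le_one (by positivity)
  rw [outMean_eq_measureReal, hset, Real.volume_real_Ioo_of_le h3, sub_zero]

/-- The left end of the region increases with `x` beyond `c`, starting from `c (1 - τ)`. Hence no
point to the right of `c` reaches `t`, and all senders satisfy the left-hand formula. -/
lemma inMean_of_le {τ c t : ℝ} (hτ0 : 0 < τ) (hτ : τ < 1) (hc0 : 0 < c) (hc1 : c < 1)
    (ht0 : 0 < t) (htc : t ≤ c * (1 - τ)) :
    inMean τ c t = (1 / (1 - τ) - c / (c + τ * (1 - c))) * t := by
  have hτ' : 0 < 1 - τ := by linarith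
  have hA : 0 < c + τ * (1 - c) := by nlinarith
  have htc' : t / (1 - τ) ≤ c := by rwa [div_le_iff₀ hτ']
  have hset : {x | t ∈ csRegion 0 1 τ c x} ∩ Ioo 0 1
      = Ioo (t * c / (c + τ * (1 - c))) (t / (1 - τ)) := by
    ext x
    rw [mem_inter_iff, mem_ofPred_eq, mem_Ioo, mem_Ioo, div_lt_iff₀ hA, lt_div_iff₀ hτ']
    constructor
    · rintro ⟨h, hx0, hx1⟩
      rcases le_or_gt x c with hxc | hxc
      · rw [mem_csRegion_left hc0 hx0 hx1 hxc, lt_div_iff₀ hc0] at h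
        exact ⟨h.1.2, h.1.1⟩
      · rw [mem_csRegion_right hc1 hx0 hx1 hxc, lt_div_iff₀ (by linarith)] at h
        have h1 : (1 - x) * (1 - c + c * τ) < (1 - c) * (1 - c + c * τ) :=
          mul_lt_mul_of_pos_right (by linarith) (by nlinarith)
        nlinarith [h.1.2]
    · rintro ⟨h1, h2⟩
      have hx0 : 0 < x := by
        have : 0 < x * (c + τ * (1 - c)) := (mul_pos ht0 hc0).trans h1
        exact pos_of_mul_pos_left this hA.le
      have hxc : x ≤ c := by
        have := (lt_div_iff₀ hτ').2 h2
        linarith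
      refine ⟨?_, hx0, by linarith⟩
      rw [mem_csRegion_left hc0 hx0 (by linarith) hxc, lt_div_iff₀ hc0]
      exact ⟨⟨h2, h1⟩, ht0, by nlinarith⟩
  have h3 : t * c / (c + τ * (1 - c)) ≤ t / (1 - τ) := by
    rw [div_le_div_iff₀ hA hτ']
    nlinarith [mul_pos ht0 hτ0]
  rw [inMean_eq_measureReal, hset, Real.volume_real_Ioo_of_le h3]
  field_simp

/-- Here the senders form an interval around `c`. Senders left of `c` are limited only by the right
end of their region, and those right of `c` only by the left end. For `τ ≥ 1` the threshold `c (1 -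
τ)` is not positive, so this case is the only one. -/
lemma inMean_of_gt {τ c t : ℝ} (hτ0 : 0 < τ) (hc0 : 0 < c) (hc1 : c < 1)
    (ht0 : 0 < t) (htc : t ≤ c) (ht : c * (1 - τ) < t) :
    inMean τ c t
      = ((1 - c) / (1 - c + c * τ) - c / (c + τ * (1 - c))) * t
        + (1 - (1 - c) / (1 - c + c * τ)) := by
  have hA : 0 < c + τ * (1 - c) := by nlinarith
  have hB : 0 < 1 - c + c * τ := by nlinarith
  have hc1' : 0 < 1 - c := by linarith
  have hlow : t * c / (c + τ * (1 - c)) < c := by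
    rw [div_lt_iff₀ hA]
    nlinarith [mul_pos hτ0 hc1']
  have hup : c < 1 - (1 - c) * (1 - t) / (1 - c + c * τ) := by
    rw [lt_sub_comm, div_lt_iff₀ hB]
    exact mul_lt_mul_of_pos_left (by linarith) hc1'
  have hup1 : 1 - (1 - c) * (1 - t) / (1 - c + c * τ) < 1 := by
    have : 0 < (1 - c) * (1 - t) / (1 - c + c * τ) :=
      div_pos (mul_pos hc1' (by linarith)) hB
    linarith
  have hset : {x | t ∈ csRegion 0 1 τ c x} ∩ Ioo 0 1
      = Ioo (t * c / (c + τ * (1 - c))) (1 - (1 - c) * (1 - t) / (1 - c + c * τ)) := by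
    ext x
    rw [mem_inter_iff, mem_ofPred_eq, mem_Ioo, mem_Ioo]
    constructor
    · rintro ⟨h, hx0, hx1⟩
      rcases le_or_gt x c with hxc | hxc
      · rw [mem_csRegion_left hc0 hx0 hx1 hxc, lt_div_iff₀ hc0] at h
        exact ⟨(div_lt_iff₀ hA).2 h.1.2, hxc.trans_lt hup⟩
      · rw [mem_csRegion_right hc1 hx0 hx1 hxc, lt_div_iff₀ hc1'] at h
        refine ⟨hlow.trans hxc, ?_⟩
        rw [lt_sub_comm, div_lt_iff₀ hB]
        linarith [h.1.2]
    · rintro ⟨h1, h2⟩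
      have hx0 : 0 < x := lt_of_le_of_lt (by positivity) h1
      have hx1 : x < 1 := h2.trans hup1
      refine ⟨?_, hx0, hx1⟩
      rcases le_or_gt x c with hxc | hxc
      · rw [mem_csRegion_left hc0 hx0 hx1 hxc, lt_div_iff₀ hc0]
        refine ⟨⟨?_, (div_lt_iff₀ hA).1 h1⟩, ht0, by linarith⟩
        rcases le_or_gt τ 1 with h | h
        · exact (mul_le_mul_of_nonneg_right hxc (by linarith)).trans_lt ht
        · exact (mul_neg_of_pos_of_neg hx0 (by linarith)).trans ht0
      · rw [mem_csRegion_right hc1 hx0 hx1 hxc, lt_div_iff₀ hc1']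
        rw [lt_sub_comm, div_lt_iff₀ hB] at h2
        refine ⟨⟨?_, by linarith⟩, ht0, by linarith⟩
        nlinarith [mul_pos hτ0 (sub_pos.2 hx1)]
  rw [inMean_eq_measureReal, hset, Real.volume_real_Ioo_of_le (hlow.trans hup).le]
  ring

end Region

/-! ### First and second moments of the projections, and the closed forms of `μ` and `ν`. -/

section Moments

/-- The integral of the square of `x ↦ α x + β` from `a` to `b`. -/
noncomputable def affineSqIntegral (α β a b : ℝ) : ℝ :=
  α ^ 2 * (b ^ 3 - a ^ 3) / 3 + α * β * (b ^ 2 - a ^ 2) + β ^ 2 * (b - a)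

lemma integral_of_eqOn_affine {f : ℝ → ℝ} {α β a b : ℝ} (hab : a ≤ b)
    (h : ∀ x ∈ Ioo a b, f x = α * x + β) :
    ∫ x in a..b, f x = α * (b ^ 2 - a ^ 2) / 2 + β * (b - a) := by
  rw [intervalIntegral.integral_congr_Ioo_of_le hab h,
    intervalIntegral.integral_add (Continuous.intervalIntegrable (by fun_prop) _ _)
      (Continuous.intervalIntegrable (by fun_prop) _ _),
    intervalIntegral.integral_const_mul, integral_id, intervalIntegral.integral_const, smul_eq_mul]
  ring

lemma integral_sq_of_eqOn_affine {f : ℝ → ℝ} {α β a b : ℝ} (hab : a ≤ b)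
    (h : ∀ x ∈ Ioo a b, f x = α * x + β) :
    ∫ x in a..b, f x ^ 2 = affineSqIntegral α β a b := by
  have h' : ∀ x ∈ Ioo a b, f x ^ 2 = α ^ 2 * x ^ 2 + 2 * α * β * x + β ^ 2 := fun x hx => by
    rw [h x hx]; ring
  rw [intervalIntegral.integral_congr_Ioo_of_le hab h',
    intervalIntegral.integral_add (Continuous.intervalIntegrable (by fun_prop) _ _)
      (Continuous.intervalIntegrable (by fun_prop) _ _),
    intervalIntegral.integral_add (Continuous.intervalIntegrable (by fun_prop) _ _)
      (Continuous.intervalIntegrable (by fun_prop) _ _),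
    intervalIntegral.integral_const_mul, intervalIntegral.integral_const_mul, integral_pow,
    integral_id, intervalIntegral.integral_const, smul_eq_mul, affineSqIntegral]
  push_cast
  ring

lemma intervalIntegrable_of_abs_le {f : ℝ → ℝ} {C : ℝ} (hf : Measurable f)
    (hC : ∀ x, |f x| ≤ C) (a b : ℝ) : IntervalIntegrable f volume a b :=
  (intervalIntegrable_const (c := C)).mono_fun hf.aestronglyMeasurable
    (.of_forall fun x => (hC x).trans (le_abs_self C))

/-- Splitting an integral over the unit interval at `c` and reflecting the second part. -/
lemma integral_unit_eq_add_reflect {f g : ℝ → ℝ} {C c : ℝ} (hf : Measurable f)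
    (hC : ∀ x, |f x| ≤ C) (hc0 : 0 < c) (hc1 : c < 1) (hg : ∀ x ∈ Ioo (0 : ℝ) 1, g (1 - x) = f x) :
    ∫ x in (0 : ℝ)..1, f x = (∫ x in (0 : ℝ)..c, f x) + ∫ x in (0 : ℝ)..(1 - c), g x := by
  have h := intervalIntegral.integral_comp_sub_left (a := c) (b := 1) g 1
  rw [sub_self] at h
  rw [← h, ← intervalIntegral.integral_add_adjacent_intervals
    (intervalIntegrable_of_abs_le hf hC 0 c) (intervalIntegrable_of_abs_le hf hC c 1)]
  congr 1
  exact intervalIntegral.integral_congr_Ioo_of_le hc1.le fun x hx =>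
    (hg x ⟨hc0.trans hx.1, hx.2⟩).symm

/-- The sum of the two conditional arc probabilities of a point. -/
noncomputable def totalMean (τ c x : ℝ) : ℝ := outMean τ c x + inMean τ c x

lemma measurable_totalMean (τ c : ℝ) : Measurable (totalMean τ c) :=
  (measurable_outMean τ c).add (measurable_inMean τ c)

lemma abs_totalMean_le (τ c x : ℝ) : |totalMean τ c x| ≤ 2 :=
  (abs_add_le _ _).trans (by linarith [abs_outMean_le τ c x, abs_inMean_le τ c x])

lemma abs_totalMean_sq_le (τ c x : ℝ) : |totalMean τ c x ^ 2| ≤ 2 ^ 2 := by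
  rw [abs_pow]
  exact pow_le_pow_left₀ (abs_nonneg _) (abs_totalMean_le τ c x) 2

lemma totalMean_reflect {τ c x : ℝ} (hc0 : 0 < c) (hc1 : c < 1) (hx : x ∈ Ioo (0 : ℝ) 1) :
    totalMean τ (1 - c) (1 - x) = totalMean τ c x := by
  rw [totalMean, totalMean, outMean_reflect hc0 hc1 hx, inMean_reflect hc0 hc1]

section

variable {τ c A B : ℝ}

lemma integral_outMean_left_of_lt_one (hτ0 : 0 < τ) (hτ : τ < 1) (hc0 : 0 < c) (hc1 : c < 1) :
    ∫ x in (0 : ℝ)..c, outMean τ c x = τ / c * c ^ 2 / 2 := by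
  rw [integral_of_eqOn_affine (α := τ / c) (β := 0) hc0.le fun x hx => by
    rw [outMean_of_lt_one hτ0 hτ hc0 hc1 hx.1 hx.2.le, add_zero]]
  ring

lemma min_one_eq_right (hc0 : 0 < c) (hA : 0 < A) {x : ℝ} (hx : x ≤ c / A) :
    min 1 (x * A / c) = A / c * x := by
  rw [min_eq_right]
  · ring
  · rw [div_le_one hc0]
    exact (le_div_iff₀ hA).1 hx

lemma min_one_eq_left (hc0 : 0 < c) (hA : 0 < A) {x : ℝ} (hx : c / A ≤ x) :
    min 1 (x * A / c) = 1 := by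
  rw [min_eq_left]
  rw [one_le_div hc0]
  exact (div_le_iff₀ hA).1 hx

/-- The right end `x A / c` reaches `1` at `x = c / A ≤ c`; beyond that point the region is the
whole interval. -/
lemma integral_outMean_left_of_one_le (hτ : 1 ≤ τ) (hc0 : 0 < c) (hc1 : c < 1)
    (hA : A = c + τ * (1 - c)) :
    ∫ x in (0 : ℝ)..c, outMean τ c x = A / c * (c / A) ^ 2 / 2 + (c - c / A) := by
  have hA1 : 1 ≤ A := by rw [hA]; nlinarith
  have hA0 : 0 < A := by linarith
  have hcA : c / A ≤ c := div_le_self hc0.le hA1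
  have hcA0 : 0 < c / A := div_pos hc0 hA0
  rw [← intervalIntegral.integral_add_adjacent_intervals
    (intervalIntegrable_of_abs_le (measurable_outMean τ c) (abs_outMean_le τ c) 0 (c / A))
    (intervalIntegrable_of_abs_le (measurable_outMean τ c) (abs_outMean_le τ c) (c / A) c),
    integral_of_eqOn_affine (α := A / c) (β := 0) hcA0.le fun x hx => by
      rw [outMean_of_one_le hτ hc0 hc1 hx.1 (hx.2.le.trans hcA), ← hA,
        min_one_eq_right hc0 hA0 hx.2.le, add_zero],
    integral_of_eqOn_affine (α := 0) (β := 1) hcA fun x hx => by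
      rw [outMean_of_one_le hτ hc0 hc1 (hcA0.trans hx.1) hx.2.le, ← hA,
        min_one_eq_left hc0 hA0 hx.1.le, zero_mul, zero_add]]
  ring

/-- Only `inMean` changes formula on `(0, c)`, at `c (1 - τ)`. -/
lemma integral_totalMean_sq_left_of_lt_one (hτ0 : 0 < τ) (hτ : τ < 1) (hc0 : 0 < c) (hc1 : c < 1)
    (hA : A = c + τ * (1 - c)) (hB : B = 1 - c + c * τ) :
    ∫ x in (0 : ℝ)..c, totalMean τ c x ^ 2
      = affineSqIntegral (τ / c + 1 / (1 - τ) - c / A) 0 0 (c * (1 - τ))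
        + affineSqIntegral (τ / c + (1 - c) / B - c / A) (1 - (1 - c) / B) (c * (1 - τ)) c := by
  have hb0 : 0 < c * (1 - τ) := mul_pos hc0 (by linarith)
  have hbc : c * (1 - τ) ≤ c := by nlinarith
  have hm := (measurable_totalMean τ c).pow_const 2
  rw [← intervalIntegral.integral_add_adjacent_intervals
      (intervalIntegrable_of_abs_le hm (abs_totalMean_sq_le τ c) 0 (c * (1 - τ)))
      (intervalIntegrable_of_abs_le hm (abs_totalMean_sq_le τ c) (c * (1 - τ)) c),
    integral_sq_of_eqOn_affine (α := τ / c + 1 / (1 - τ) - c / A) (β := 0) hb0.le fun x hx => by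
      rw [totalMean, outMean_of_lt_one hτ0 hτ hc0 hc1 hx.1 (hx.2.le.trans hbc),
        inMean_of_le hτ0 hτ hc0 hc1 hx.1 hx.2.le, ← hA]; ring,
    integral_sq_of_eqOn_affine (α := τ / c + (1 - c) / B - c / A) (β := 1 - (1 - c) / B) hbc
      fun x hx => by
      rw [totalMean, outMean_of_lt_one hτ0 hτ hc0 hc1 (hb0.trans hx.1) hx.2.le,
        inMean_of_gt hτ0 hc0 hc1 (hb0.trans hx.1) hx.2.le hx.1, ← hA, ← hB]; ring]

/-- Now `inMean` has a single formula on `(0, c)`, and the break at `c / A` comes from `outMean`. -/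
lemma integral_totalMean_sq_left_of_one_le (hτ : 1 ≤ τ) (hc0 : 0 < c) (hc1 : c < 1)
    (hA : A = c + τ * (1 - c)) (hB : B = 1 - c + c * τ) :
    ∫ x in (0 : ℝ)..c, totalMean τ c x ^ 2
      = affineSqIntegral (A / c + (1 - c) / B - c / A) (1 - (1 - c) / B) 0 (c / A)
        + affineSqIntegral ((1 - c) / B - c / A) (2 - (1 - c) / B) (c / A) c := by
  have hA1 : 1 ≤ A := by rw [hA]; nlinarith
  have hA0 : 0 < A := by linarith
  have hcA : c / A ≤ c := div_le_self hc0.le hA1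
  have hcA0 : 0 < c / A := div_pos hc0 hA0
  have hτ0 : 0 < τ := by linarith
  have hin : ∀ x, 0 < x → c * (1 - τ) < x := fun x hx =>
    (mul_nonpos_of_nonneg_of_nonpos hc0.le (by linarith)).trans_lt hx
  have hm := (measurable_totalMean τ c).pow_const 2
  rw [← intervalIntegral.integral_add_adjacent_intervals
      (intervalIntegrable_of_abs_le hm (abs_totalMean_sq_le τ c) 0 (c / A))
      (intervalIntegrable_of_abs_le hm (abs_totalMean_sq_le τ c) (c / A) c),
    integral_sq_of_eqOn_affine (α := A / c + (1 - c) / B - c / A) (β := 1 - (1 - c) / B) hcA0.le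
      fun x hx => by
      rw [totalMean, outMean_of_one_le hτ hc0 hc1 hx.1 (hx.2.le.trans hcA),
        inMean_of_gt hτ0 hc0 hc1 hx.1 (hx.2.le.trans hcA) (hin x hx.1), ← hA, ← hB,
        min_one_eq_right hc0 hA0 hx.2.le]; ring,
    integral_sq_of_eqOn_affine (α := (1 - c) / B - c / A) (β := 2 - (1 - c) / B) hcA
      fun x hx => by
      rw [totalMean, outMean_of_one_le hτ hc0 hc1 (hcA0.trans hx.1) hx.2.le,
        inMean_of_gt hτ0 hc0 hc1 (hcA0.trans hx.1) hx.2.le (hin x (hcA0.trans hx.1)), ← hA, ← hB,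
        min_one_eq_left hc0 hA0 hx.1.le]; ring]

end

variable {τ c : ℝ}

/-- The closed form is invariant under `c ↦ 1 - c`, so the distinction at `c = 1/2` disappears. -/
lemma csMean_eq_csMean₁ (τ c : ℝ) : csMean τ c = csMean₁ τ c := by
  unfold csMean
  split_ifs
  · rfl
  · unfold csMean₁
    split_ifs
    · rfl
    · congr 1 <;> ring

lemma csNu_eq_csNu₁ (τ c : ℝ) : csNu τ c = csNu₁ τ c := by
  unfold csNu
  split_ifs
  · rfl
  · unfold csNu₁ csKappa₁ csKappa₂
    split_ifs
    · congr 2 <;> ring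
    -- The two factors of the denominator are exchanged, each with a change of sign; the signs of
    -- the two cubes cancel.
    · rw [show (1 - c) * τ - (1 - c) - τ = -(c * τ - c + 1) by ring,
        show (1 - c) * τ - (1 - c) + 1 = -(c * τ - c - τ) by ring]
      congr 2 <;> ring

theorem integral_outMean (hτ : 0 < τ) (hc0 : 0 < c) (hc1 : c < 1) :
    ∫ x, outMean τ c x ∂unitUniform = csMean τ c := by
  have hc0' : 0 < 1 - c := by linarith
  have hc1' : 1 - c < 1 := by linarith
  rw [integral_unitUniform, integral_unit_eq_add_reflect (measurable_outMean τ c)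
    (abs_outMean_le τ c) hc0 hc1 fun x hx => outMean_reflect hc0 hc1 hx, csMean_eq_csMean₁]
  rcases lt_or_ge τ 1 with h | h
  · rw [integral_outMean_left_of_lt_one hτ h hc0 hc1,
      integral_outMean_left_of_lt_one hτ h hc0' hc1', csMean₁, if_pos h]
    field_simp
    ring
  · obtain ⟨A, hA⟩ : ∃ A, A = c + τ * (1 - c) := ⟨_, rfl⟩
    obtain ⟨B, hB⟩ : ∃ B, B = 1 - c + c * τ := ⟨_, rfl⟩
    have hA0 : 0 < A := by rw [hA]; nlinarith
    have hB0 : 0 < B := by rw [hB]; nlinarith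
    rw [integral_outMean_left_of_one_le h hc0 hc1 hA,
      integral_outMean_left_of_one_le h hc0' hc1' (A := B) (by rw [hB]; ring), csMean₁,
      if_neg (not_lt.2 h), show c * τ - c + 1 = B by rw [hB]; ring,
      show τ + c - c * τ = A by rw [hA]; ring]
    field_simp
    rw [hA, hB]
    ring

theorem integral_totalMean_sq (hτ : 0 < τ) (hc0 : 0 < c) (hc1 : c < 1) :
    ∫ x, totalMean τ c x ^ 2 ∂unitUniform = 4 * csNu τ c + (2 * csMean τ c) ^ 2 := by
  have hc0' : 0 < 1 - c := by linarith
  have hc1' : 1 - c < 1 := by linarith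
  obtain ⟨A, hA⟩ : ∃ A, A = c + τ * (1 - c) := ⟨_, rfl⟩
  obtain ⟨B, hB⟩ : ∃ B, B = 1 - c + c * τ := ⟨_, rfl⟩
  have hA0 : 0 < A := by rw [hA]; nlinarith
  have hB0 : 0 < B := by rw [hB]; nlinarith
  -- Under `c ↦ 1 - c` the quantities `A` and `B` change places, so the formula for the left part
  -- also serves for the reflected right part. Both stay opaque while denominators are cleared.
  have hA' : A = 1 - (1 - c) + (1 - c) * τ := by rw [hA]; ring
  have hB' : B = 1 - c + τ * (1 - (1 - c)) := by rw [hB]; ring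
  have e1 : c * τ - c + 1 = B := by rw [hB]; ring
  have e2 : c + τ - c * τ = A := by rw [hA]; ring
  have e3 : τ + c - c * τ = A := by rw [hA]; ring
  have e4 : c * τ - c - τ = -A := by rw [hA]; ring
  rw [integral_unitUniform, integral_unit_eq_add_reflect ((measurable_totalMean τ c).pow_const 2)
    (abs_totalMean_sq_le τ c) hc0 hc1 (g := fun x => totalMean τ (1 - c) x ^ 2)
    fun x hx => congrArg (· ^ 2) (totalMean_reflect hc0 hc1 hx), csMean_eq_csMean₁,
    csNu_eq_csNu₁, csNu₁, mul_div_cancel₀ _ (four_ne_zero)]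
  rcases lt_or_ge τ 1 with h | h
  · have h4 : 1 - τ ≠ 0 := by linarith
    rw [integral_totalMean_sq_left_of_lt_one hτ h hc0 hc1 hA hB,
      integral_totalMean_sq_left_of_lt_one hτ h hc0' hc1' hB' hA', csMean₁, if_pos h, if_pos h,
      csKappa₁, e1, e2, sub_sub_cancel]
    unfold affineSqIntegral
    field_simp
    rw [hA, hB]
    ring
  · rw [integral_totalMean_sq_left_of_one_le h hc0 hc1 hA hB,
      integral_totalMean_sq_left_of_one_le h hc0' hc1' hB' hA', csMean₁, if_neg (not_lt.2 h),
      if_neg (not_lt.2 h), csKappa₂, e1, e3, e4, sub_sub_cancel]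
    unfold affineSqIntegral
    field_simp
    rw [hA, hB]
    ring

theorem csNu_pos (hτ : 0 < τ) (hc0 : 0 < c) (hc1 : c < 1) : 0 < csNu τ c := by
  have hA : 0 < c + τ - c * τ := by nlinarith
  have hB : 0 < c * τ - c + 1 := by nlinarith
  obtain ⟨p, hp⟩ : ∃ p, p = c * (1 - c) := ⟨_, rfl⟩
  have hp0 : 0 < p := by rw [hp]; exact mul_pos hc0 (by linarith)
  have hp1 : 0 ≤ 1 - 4 * p := by rw [hp]; nlinarith [sq_nonneg (1 - 2 * c)]
  rw [csNu_eq_csNu₁, csNu₁]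
  refine div_pos ?_ four_pos
  split_ifs with h
  · rw [csKappa₁]
    refine div_pos (mul_pos (pow_pos hτ 2) ?_) (mul_pos (mul_pos three_pos hB) hA)
    -- The second factor of the numerator equals `τ (1 - τ) + p ((1 - τ)² + τ² (2 - τ))`.
    have h1 : 0 < τ * (1 - τ) := mul_pos hτ (by linarith)
    have h2 : 0 ≤ p * ((1 - τ) ^ 2 + τ ^ 2 * (2 - τ)) :=
      mul_nonneg hp0.le (add_nonneg (sq_nonneg _) (mul_nonneg (sq_nonneg _) (by linarith)))
    rw [hp] at h2
    linarith
  · have h1 : 1 ≤ τ := not_lt.1 h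
    rw [csKappa₂, show c * τ - c - τ = -(c + τ - c * τ) by ring, Odd.neg_pow (by decide : Odd 3),
      mul_neg, div_neg, ← neg_div]
    refine div_pos ?_ (mul_pos (mul_pos three_pos (pow_pos hB 3)) (pow_pos hA 3))
    -- `-Q` is the sum of the expressions in `t5`, `t4`, `t3` and `t2`: its coefficients in `τ`
    -- depend on `c` through `p` alone, and each group is nonnegative since `τ ≥ 1` and `p ≤ 1/4`.
    have t5 : 0 ≤ p * (1 - 2 * p) * (τ ^ 5 - τ) := by
      refine mul_nonneg (mul_nonneg hp0.le (by linarith)) (sub_nonneg.2 ?_)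
      exact le_self_pow₀ h1 (by norm_num)
    have t4 : 0 < p ^ 2 * (7 * τ ^ 4 - 1) :=
      mul_pos (pow_pos hp0 2) (by linarith [one_le_pow₀ (n := 4) h1])
    have t3 : 0 ≤ 4 * p * (1 - 2 * p) * τ ^ 3 :=
      mul_nonneg (mul_nonneg (by linarith) (by linarith)) (by positivity)
    have t2 : 0 ≤ (1 - 4 * p + 2 * p ^ 2) * τ ^ 2 := mul_nonneg (by positivity) (by positivity)
    rw [← mul_neg, ← hp]
    refine mul_pos hp0 ?_
    have h := add_pos_of_nonneg_of_pos (add_nonneg (add_nonneg t5 t3) t2) t4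
    refine h.trans_eq ?_
    rw [hp]
    ring

end Moments

/-! ### From the unit interval back to the digraph on `(y₁, y₂)`. -/

section Transfer

lemma measurable_unitArc_swap (τ c : ℝ) :
    Measurable (Function.uncurry fun x y => unitArc τ c y x) :=
  (measurable_unitArc τ c).comp measurable_swap

lemma integral_inMean (τ c : ℝ) :
    ∫ x, inMean τ c x ∂unitUniform = ∫ x, outMean τ c x ∂unitUniform :=
  integral_integral_swap (f := fun x y => unitArc τ c y x)
    (integrable_of_measurable_of_abs_le (measurable_unitArc_swap τ c)
      fun _ => abs_unitArc_le τ c _ _)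

theorem variance_totalMean {τ c : ℝ} (hτ : 0 < τ) (hc0 : 0 < c) (hc1 : c < 1) :
    Var[totalMean τ c; unitUniform] = 4 * csNu τ c := by
  have hT : ∫ x, totalMean τ c x ∂unitUniform = 2 * csMean τ c := by
    simp only [totalMean]
    rw [integral_add (integrable_of_measurable_of_abs_le (measurable_outMean τ c)
        (abs_outMean_le τ c))
      (integrable_of_measurable_of_abs_le (measurable_inMean τ c) (abs_inMean_le τ c)),
      integral_inMean, integral_outMean hτ hc0 hc1, two_mul]
  rw [variance_eq_sub (MemLp.of_bound (measurable_totalMean τ c).aestronglyMeasurable 2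
    (.of_forall (abs_totalMean_le τ c)))]
  simp only [Pi.pow_apply]
  rw [integral_totalMean_sq hτ hc0 hc1, hT, add_sub_cancel_right]

lemma csKernel_zero_one (τ c x y : ℝ) :
    csKernel 0 1 τ c x y = 2⁻¹ * (unitArc τ c x y + unitArc τ c y x) := by
  rw [csKernel, unitArc, unitArc, div_eq_inv_mul]

lemma measurable_csKernel (τ c : ℝ) : Measurable (Function.uncurry (csKernel 0 1 τ c)) := by
  have h : Function.uncurry (csKernel 0 1 τ c) = fun p : ℝ × ℝ =>
      2⁻¹ * (Function.uncurry (unitArc τ c) p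
        + Function.uncurry (fun x y => unitArc τ c y x) p) := by
    ext ⟨x, y⟩
    exact csKernel_zero_one τ c x y
  rw [h]
  exact ((measurable_unitArc τ c).add (measurable_unitArc_swap τ c)).const_mul _

lemma abs_csKernel_le (τ c x y : ℝ) : |csKernel 0 1 τ c x y| ≤ 1 := by
  have h1 := abs_le.1 (abs_unitArc_le τ c x y)
  have h2 := abs_le.1 (abs_unitArc_le τ c y x)
  rw [csKernel_zero_one, abs_le]
  constructor <;> linarith

/-- The kernel averages the two arc directions; this factor `1/2` is the source of the `4` in `4ν`.
-/
lemma integral_csKernel (τ c x : ℝ) :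
    ∫ y, csKernel 0 1 τ c x y ∂unitUniform = 2⁻¹ * totalMean τ c x := by
  simp only [csKernel_zero_one]
  rw [integral_const_mul, integral_add]
  · rfl
  · exact integrable_of_measurable_of_abs_le
      ((measurable_unitArc τ c).comp measurable_prodMk_left) (abs_unitArc_le τ c x)
  · exact integrable_of_measurable_of_abs_le
      ((measurable_unitArc τ c).comp measurable_prodMk_right) fun y => abs_unitArc_le τ c y x

lemma csKernel_affine {y₁ y₂ : ℝ} (hy : y₁ < y₂) (τ c x y : ℝ) :
    csKernel y₁ y₂ τ c (y₁ + (y₂ - y₁) * x) (y₁ + (y₂ - y₁) * y) = csKernel 0 1 τ c x y := by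
  have h : ∀ u v, (csRegion y₁ y₂ τ c (y₁ + (y₂ - y₁) * u)).indicator (fun _ => (1 : ℝ))
      (y₁ + (y₂ - y₁) * v) = (csRegion 0 1 τ c u).indicator (fun _ => (1 : ℝ)) v := fun u v => by
    have := affine_mem_csRegion_iff hy τ c u v
    by_cases hv : v ∈ csRegion 0 1 τ c u <;> simp [this, hv]
  rw [csKernel, csKernel, h, h]

lemma csDigraph_affine {y₁ y₂ : ℝ} (hy : y₁ < y₂) (τ c : ℝ) {n : ℕ} (x : Fin n → ℝ) :
    csDigraph y₁ y₂ τ c (fun i => y₁ + (y₂ - y₁) * x i) = csDigraph 0 1 τ c x := by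
  ext i j
  simp only [csDigraph, affine_mem_csRegion_iff hy]

lemma sum_offDiag_range_eq (n : ℕ) (f : ℕ → ℕ → ℝ) :
    ∑ p ∈ (Finset.range n).offDiag, f p.1 p.2
      = ∑ p ∈ (Finset.univ : Finset (Fin n)).offDiag, f p.1 p.2 := by
  refine (Finset.sum_nbij (fun p : Fin n × Fin n => ((p.1 : ℕ), (p.2 : ℕ))) ?_ ?_ ?_ ?_).symm
  · rintro ⟨i, j⟩ h
    simpa [Fin.ext_iff] using h
  · rintro ⟨i, j⟩ - ⟨k, l⟩ - h
    simpa [Fin.ext_iff] using h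
  · rintro ⟨i, j⟩ h
    simp only [Finset.coe_offDiag, Finset.coe_range, mem_offDiag, mem_Iio] at h
    exact ⟨(⟨i, h.1⟩, ⟨j, h.2.1⟩), by simpa using h.2.2, rfl⟩
  · exact fun _ _ => rfl

/-- The absence of loops matches the off-diagonal sum. No lower bound on `n` is needed, as both
sides have the same denominator. -/
lemma relativeDensity_csDigraph (τ c : ℝ) (n : ℕ) (x : ℕ → ℝ) :
    relativeDensity (csDigraph 0 1 τ c fun i : Fin n => x i)
      = (∑ p ∈ (Finset.range n).offDiag, unitArc τ c (x p.1) (x p.2))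
        / ((n : ℝ) * ((n : ℝ) - 1)) := by
  classical
  rw [relativeDensity, sum_offDiag_range_eq n fun i j => unitArc τ c (x i) (x j)]
  congr 1
  have h : {p : Fin n × Fin n | (csDigraph 0 1 τ c fun i : Fin n => x i).Adj p.1 p.2}
      = ((Finset.univ : Finset (Fin n)).offDiag.filter
          fun p => x p.2 ∈ csRegion 0 1 τ c (x p.1) : Finset (Fin n × Fin n)) := by
    ext p
    simp [csDigraph]
  rw [h, ncard_coe_finset, Finset.card_filter, Nat.cast_sum]
  refine Finset.sum_congr rfl fun p _ => ?_
  by_cases hp : x p.2 ∈ csRegion 0 1 τ c (x p.1) <;> simp [unitArc, hp]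

lemma volume_preimage_standardize {y₁ y₂ : ℝ} (hy : y₁ < y₂) (A : Set ℝ) :
    volume (Ioo y₁ y₂ ∩ (fun x => (x - y₁) * (y₂ - y₁)⁻¹) ⁻¹' A) / volume (Ioo y₁ y₂)
      = volume (A ∩ Ioo 0 1) := by
  have hd : 0 < y₂ - y₁ := sub_pos.2 hy
  have hset : Ioo y₁ y₂ ∩ (fun x => (x - y₁) * (y₂ - y₁)⁻¹) ⁻¹' A
      = (fun x => x + -y₁) ⁻¹' ((fun x => x * (y₂ - y₁)⁻¹) ⁻¹' (A ∩ Ioo 0 1)) := by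
    ext x
    simp only [mem_inter_iff, mem_preimage, mem_Ioo, ← sub_eq_add_neg, ← div_eq_mul_inv, div_lt_one hd,
      div_pos_iff_of_pos_right hd, sub_pos, sub_lt_sub_iff_right]
    exact and_comm
  rw [hset, measure_preimage_add_right, Real.volume_preimage_mul_right (inv_ne_zero hd.ne'),
    inv_inv, abs_of_pos hd, Real.volume_Ioo, mul_comm]
  exact ENNReal.mul_div_cancel_right (by simpa using hy) ENNReal.ofReal_ne_top

/-- Variables which are independent and uniform on an interval are almost surely affine images of
measurable variables which are independent and uniform on the unit interval. -/
lemma exists_standardization {Ω : Type*} [MeasurableSpace Ω] {P : Measure Ω}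
    {y₁ y₂ : ℝ} (hy : y₁ < y₂) {X : ℕ → Ω → ℝ}
    (hX_unif : ∀ i, pdf.IsUniform (X i) (Ioo y₁ y₂) P volume) (hX_indep : iIndepFun X P) :
    ∃ U : ℕ → Ω → ℝ, (∀ i, Measurable (U i)) ∧ iIndepFun U P ∧
      (∀ i, P.map (U i) = unitUniform) ∧
      ∀ᵐ ω ∂P, ∀ i, X i ω = y₁ + (y₂ - y₁) * U i ω := by
  have hd : 0 < y₂ - y₁ := sub_pos.2 hy
  have hns : volume (Ioo y₁ y₂) ≠ 0 := by simpa using hy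
  have hnt : volume (Ioo y₁ y₂) ≠ ⊤ := by simp
  have hXm : ∀ i, AEMeasurable (X i) P := fun i => (hX_unif i).aemeasurable hns hnt
  set φ : ℝ → ℝ := fun x => (x - y₁) * (y₂ - y₁)⁻¹ with hφ_def
  have hφ : Measurable φ := by fun_prop
  -- Uniformity yields only almost everywhere measurability of `X i`, so a measurable modification
  -- is standardized.
  refine ⟨fun i => φ ∘ (hXm i).mk, fun i => hφ.comp (hXm i).measurable_mk, ?_, fun i => ?_, ?_⟩
  · exact (hX_indep.congr fun i => (hXm i).ae_eq_mk).comp (fun _ => φ) fun _ => hφ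
  · have hae : φ ∘ (hXm i).mk =ᵐ[P] φ ∘ X i := (hXm i).ae_eq_mk.symm.fun_comp φ
    rw [Measure.map_congr hae]
    ext A hA
    rw [Measure.map_apply_of_aemeasurable (hφ.comp_aemeasurable (hXm i)) hA, preimage_comp,
      (hX_unif i).measure_preimage hns hnt (hφ hA), volume_preimage_standardize hy, unitUniform,
      Measure.restrict_apply hA]
  · filter_upwards [ae_all_iff.2 fun i => (hXm i).ae_eq_mk] with ω hω i
    rw [hω i, Function.comp_apply, hφ_def]
    field_simp
    ring

end Transfer

theorem mainTheorem1 {Ω : Type*} [MeasurableSpace Ω] (P : Measure Ω) [IsProbabilityMeasure P]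
    (y₁ y₂ : ℝ) (hy : y₁ < y₂) (X : ℕ → Ω → ℝ)
    (hX_unif : ∀ i, pdf.IsUniform (X i) (Set.Ioo y₁ y₂) P volume)
    (hX_indep : iIndepFun X P)
    (τ : ℝ) (hτ : 0 < τ) (c : ℝ) (hc0 : 0 < c) (hc1 : c < 1) :
    -- the arc probability is `μ(τ, c)`
    (∀ i j : ℕ, i ≠ j →
      P.real {ω | X j ω ∈ csRegion y₁ y₂ τ c (X i ω)} = csMean τ c) ∧
    -- the covariance of the kernel is `ν(τ, c)`, and it is positive
    (∀ i j k : ℕ, i ≠ j → i ≠ k → j ≠ k →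
      covariance (fun ω => csKernel y₁ y₂ τ c (X i ω) (X j ω))
        (fun ω => csKernel y₁ y₂ τ c (X i ω) (X k ω)) P = csNu τ c) ∧
    0 < csNu τ c ∧
    -- convergence in law to the normal distribution `N(0, 4 ν(τ, c))`
    TendstoInDistribution
      (fun (n : ℕ) (ω : Ω) => Real.sqrt (n : ℝ) *
        (relativeDensity (csDigraph y₁ y₂ τ c (fun i : Fin n => X i ω)) - csMean τ c))
      atTop (id : ℝ → ℝ) (fun _ => P) (gaussianReal 0 (4 * csNu τ c).toNNReal) := by
  obtain ⟨U, hUm, hU, hlaw, hXU⟩ := exists_standardization hy hX_unif hX_indep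
  refine ⟨fun i j hij => ?_, fun i j k hij hik hjk => ?_, csNu_pos hτ hc0 hc1, ?_⟩
  · have hset : {ω | X j ω ∈ csRegion y₁ y₂ τ c (X i ω)}
        =ᵐ[P] {ω | U j ω ∈ csRegion 0 1 τ c (U i ω)} := by
      filter_upwards [hXU] with ω hω
      refine propext ?_
      change X j ω ∈ csRegion y₁ y₂ τ c (X i ω) ↔ U j ω ∈ csRegion 0 1 τ c (U i ω)
      rw [hω i, hω j, affine_mem_csRegion_iff hy]
    have hmeas : MeasurableSet {ω | U j ω ∈ csRegion 0 1 τ c (U i ω)} :=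
      ((hUm i).prodMk (hUm j)) (measurableSet_csRegion 0 1 τ c)
    rw [measureReal_congr hset, ← integral_outMean hτ hc0 hc1]
    refine Eq.trans ?_ (integral_comp_two hUm hU hlaw (measurable_unitArc τ c)
      (abs_unitArc_le τ c) hij)
    rw [← integral_indicator_one hmeas]
    rfl
  · have hae : ∀ l, (fun ω => csKernel y₁ y₂ τ c (X i ω) (X l ω))
        =ᵐ[P] fun ω => csKernel 0 1 τ c (U i ω) (U l ω) := fun l => by
      filter_upwards [hXU] with ω hω
      rw [hω i, hω l, csKernel_affine hy]
    have hcov := covariance_comp_pairs hUm hU hlaw (measurable_csKernel τ c)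
      (abs_csKernel_le τ c) hij hik hjk
    simp only [covariance] at hcov ⊢
    rw [integral_congr_ae (hae j), integral_congr_ae (hae k)]
    refine (integral_congr_ae ?_).trans (hcov.trans ?_)
    · filter_upwards [hae j, hae k] with ω hj hk
      rw [hj, hk]
    simp only [integral_csKernel]
    rw [variance_const_mul, variance_totalMean hτ hc0 hc1]
    ring
  · have hclt := tendstoInDistribution_average_offDiag hUm hU hlaw (measurable_unitArc τ c)
      (abs_unitArc_le τ c)
    have hmean : ∫ x, ∫ y, unitArc τ c x y ∂unitUniform ∂unitUniform = csMean τ c :=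
      integral_outMean hτ hc0 hc1
    have hvar : Var[fun x => ∫ y, unitArc τ c x y ∂unitUniform
        + ∫ y, unitArc τ c y x ∂unitUniform; unitUniform] = 4 * csNu τ c :=
      variance_totalMean hτ hc0 hc1
    rw [hmean, hvar] at hclt
    -- Convergence in law sees the statistics only up to null sets, and almost surely the digraph of
    -- the `X i` is that of the `U i`.
    refine hclt.congr (fun n => ?_) .rfl
    filter_upwards [hXU] with ω hω
    simp only [hω]
    rw [csDigraph_affine hy τ c fun i : Fin n => U i ω,
      relativeDensity_csDigraph τ c n fun i => U i ω]
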